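/- Definitions. An entourage on a set $X$ is a set $E\subseteq X\times X$ containing the diagonal; put $E[x]=\{y:(x,y)\in E\}$, $E^{-1}=\{(y,x):(x,y)\in E\}$ and $E\circ F=\{(x,z):\exists y\;(x,y)\in E,\ (y,z)\in F\}$. A coarse structure on $X$ is a family $\mathcal E$ of entourages on $X$ with $\bigcup\mathcal E=X\times X$, such that for all $E,F\in\mathcal E$ there is $G\in\mathcal E$ with $E\circ F^{-1}\subseteq G$, and such that every entourage contained in a member of $\mathcal E$ belongs to $\mathcal E$. A base of $\mathcal E$ is a subfamily $\mathcal B\subseteq\mathcal E$ such that each $E\in\mathcal E$ is contained in some $B\in\mathcal B$. The structure $\mathcal E$ is cellular if it has a base consisting of equivalence relations, and finitary if for every $E\in\mathcal E$ there is $n\in\mathbb N$ with $|E[x]|\le n$ for all $x\in X$. A set $B\subseteq X$ is bounded if $B\subseteq E[x]$ for some $E\in\mathcal E$, $x\in X$. A set $D\subseteq X$ is $\mathcal E$-discrete if for every $E\in\mathcal E$ there is a bounded set $B$ with $D\cap E[x]=\{x\}$ for all $x\in D\setminus B$. Let $\mathfrak{as}$ be the least cardinality of a base of a cellular finitary coarse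 structure $\mathcal E$ on $\omega$ that has no infinite $\mathcal E$-discrete subset, and let $\mathfrak c$ be the cardinality of the continuum. Let $M$ be a metric space with at least two points in which every closed bounded set is compact. A function $\varphi:X\to M$ on a coarse space $(X,\mathcal E)$ is slowly oscillating if for all $\varepsilon>0$ and $E\in\mathcal E$ there is a bounded set $B\subseteq X$ with $\operatorname{diam}\varphi(E[x])<\varepsilon$ for all $x\in X\setminus B$. Let $S$ be the set of all bounded slowly oscillating functions $X\to M$. The $M$-compactification $h_M(X,\mathcal E)$ is the closure in $M^{S}$ of the set of points $(f(x))_{f\in S}$, $x\in X$; the point $x\in X$ is identified with $(f(x))_{f\in S}$. A compactification is a compact Hausdorff space $K$ whose set $K'$ of isolated points is dense in $K$. For $\varphi:K'\to M$ and $z\in K$ let $\operatorname{osc}_z(\varphi)$ be the infimum of $\operatorname{diam}\varphi(K'\cap O)$ over all open neighbourhoods $O$ of $z$. The compactification $K$ is $M$-soft if for every bounded function $\varphi:K'\to M$ with $\operatorname{osc}_z(\varphi)>0$ for some $z\in K$ there are a homeomorphism $g:K\to K$ with $g(z)=z$ for all $z\in K\setminus K'$ and $\varepsilon>0$ such that $d_M(\varphi(g(x)),\varphi(x))\ge\varepsilon$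 for infinitely many $x\in K'$. Two compactifications $K_1,K_2$ with the same set $X$ of isolated points are $M$-equivalent if the restrictions to $X$ of the continuous functions $K_1\to M$ are the same functions as the restrictions to $X$ of the continuous functions $K_2\to M$. Theorem. Assume $\mathfrak{as}=\mathfrak c$. Then for every separable $M$-soft compactification $K$ there is a cellular finitary coarse structure $\mathcal E$ on the set $K'$ of isolated points of $K$ such that $h_M(K',\mathcal E)$ is a compactification with set of isolated points $K'$, and $K$ is $M$-equivalent to $h_M(K',\mathcal E)$. -/

import Mathlib

open Set Topology Cardinal
open scoped SetRel

universe u v w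

/-- A coarse structure on a set `X`, given by its family of entourages. -/
structure CoarseStructure (X : Type u) where
  /-- the entourages -/
  entourages : Set (SetRel X X)
  diag_mem : ∀ E ∈ entourages, ∀ x : X, (x, x) ∈ E
  sUnion_eq : ⋃₀ entourages = (univ : Set (X × X))
  comp_inv : ∀ E ∈ entourages, ∀ F ∈ entourages, ∃ G ∈ entourages, E ○ F.inv ⊆ G
  down_closed : ∀ E F : SetRel X X, (∀ x : X, (x, x) ∈ E) → E ⊆ F → F ∈ entourages →
    E ∈ entourages

/-- The ball `E[x] = {y : (x, y) ∈ E}`. -/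
def entBall {X : Type u} (E : SetRel X X) (x : X) : Set X := {y | (x, y) ∈ E}

namespace CoarseStructure

variable {X : Type u}

/-- A base of a coarse structure: a cofinal subfamily of its entourages. -/
def IsBase (C : CoarseStructure X) (B : Set (SetRel X X)) : Prop :=
  B ⊆ C.entourages ∧ ∀ E ∈ C.entourages, ∃ F ∈ B, E ⊆ F

/-- Cellular: there is a base that consists of equivalence relations. -/
def IsCellular (C : CoarseStructure X) : Prop :=
  ∃ B : Set (SetRel X X), C.IsBase B ∧ ∀ E ∈ B, Equivalence (fun x y : X => (x, y) ∈ E)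

/-- Finitary: for each entourage `E` the cardinalities of the balls `E[x]` are bounded by a
natural number. -/
def IsFinitary (C : CoarseStructure X) : Prop :=
  ∀ E ∈ C.entourages, ∃ n : ℕ, ∀ x : X, (entBall E x).encard ≤ n

/-- Bounded subsets of a coarse space. -/
def IsBounded (C : CoarseStructure X) (A : Set X) : Prop :=
  ∃ E ∈ C.entourages, ∃ x : X, A ⊆ entBall E x

/-- Discrete (also called thin) subsets of a coarse space. -/
def IsDiscreteSubset (C : CoarseStructure X) (D : Set X) : Prop :=
  ∀ E ∈ C.entourages, ∃ A : Set X, C.IsBounded A ∧ ∀ x ∈ D \ A, D ∩ entBall E x = {x}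

/-- Slowly oscillating functions on a coarse space with values in a metric space. -/
def SlowlyOscillating (C : CoarseStructure X) {M : Type v} [MetricSpace M] (φ : X → M) : Prop :=
  ∀ ε : ℝ, 0 < ε → ∀ E ∈ C.entourages, ∃ A : Set X, C.IsBounded A ∧
    ∀ x ∉ A, Metric.ediam (φ '' entBall E x) < ENNReal.ofReal ε

/-- The family of all bounded slowly oscillating `M`-valued functions. -/
def so (C : CoarseStructure X) (M : Type v) [MetricSpace M] : Set (X → M) :=
  {φ | Bornology.IsBounded (range φ) ∧ C.SlowlyOscillating φ}

/-- The map `x ↦ (f x)_f` of `X` to the product `M ^ so`. -/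
def evalMap (C : CoarseStructure X) (M : Type v) [MetricSpace M] (x : X) : C.so M → M :=
  fun f => f.1 x

/-- The `M`-compactification (`M`-Higson compactification) of a coarse space: the closure of the
image of `X` in the product `M ^ so`, with the subspace topology. -/
abbrev MCompactification (C : CoarseStructure X) (M : Type v) [MetricSpace M] :
    Type (max u v) :=
  closure (range (C.evalMap M))

/-- The canonical map of `X` to its `M`-compactification. -/
def toMCompactification (C : CoarseStructure X) (M : Type v) [MetricSpace M] (x : X) :
    C.MCompactification M :=
  ⟨C.evalMap M x, subset_closure (mem_range_self x)⟩

end CoarseStructure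

/-- The cardinal `𝔞𝔰`: the least cardinality of a base of a cellular finitary coarse structure on
`ω` that has no infinite discrete subset. -/
noncomputable def cardinalAS : Cardinal.{0} :=
  sInf {κ | ∃ C : CoarseStructure ℕ, C.IsCellular ∧ C.IsFinitary ∧
    (∀ D : Set ℕ, D.Infinite → ¬ C.IsDiscreteSubset D) ∧
    ∃ B : Set (SetRel ℕ ℕ), C.IsBase B ∧ #B = κ}

/-- The set of isolated points of a topological space. -/
def isolatedPoints (K : Type u) [TopologicalSpace K] : Set K := {x | IsOpen ({x} : Set K)}

theorem Homeomorph.mem_isolatedPoints {K : Type u} [TopologicalSpace K] (g : K ≃ₜ K) {x : K}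
    (hx : x ∈ isolatedPoints K) : g x ∈ isolatedPoints K := by
  have h : IsOpen (g '' {x}) := g.isOpenMap _ hx
  rwa [image_singleton] at h

/-- A compactification: a compact Hausdorff space in which the isolated points are dense. -/
structure IsCompactification (K : Type u) [TopologicalSpace K] : Prop where
  compact : CompactSpace K
  t2 : T2Space K
  dense : Dense (isolatedPoints K)

/-- `K` is a compactification whose set of isolated points is identified with `X` by means of the
map `i : X → K`. -/
structure IsCompactificationOf {X : Type u} {K : Type v} [TopologicalSpace K] (i : X → K) :
    Prop where
  isCompactification : IsCompactification K
  injective : Function.Injective i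
  range_eq : range i = isolatedPoints K

/-- The family of restrictions to `X` of the continuous functions `K → M`, where `X` is identified
with a subset of `K` by means of `i : X → K`. -/
def uc {X : Type u} {K : Type v} [TopologicalSpace K] (i : X → K) (M : Type w) [MetricSpace M] :
    Set (X → M) :=
  {φ | ∃ f : C(K, M), ∀ x, f (i x) = φ x}

/-- `M`-equivalence of two compactifications of the same set `X` (which is identified with the sets
of their isolated points). -/
structure MEquivalent {X : Type*} {K₁ : Type*} {K₂ : Type*} [TopologicalSpace K₁]
    [TopologicalSpace K₂] (M : Type*) [MetricSpace M] (i₁ : X → K₁) (i₂ : X → K₂) : Prop where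
  left : IsCompactificationOf i₁
  right : IsCompactificationOf i₂
  uc_eq : uc i₁ M = uc i₂ M

/-- The oscillation at `z ∈ K` of a function that is defined on a subset `X` of `K`. -/
noncomputable def osc {K : Type u} [TopologicalSpace K] {M : Type v} [MetricSpace M] {X : Set K}
    (φ : X → M) (z : K) : ENNReal :=
  ⨅ (O : Set K) (_ : IsOpen O) (_ : z ∈ O), Metric.ediam (φ '' (Subtype.val ⁻¹' O))

/-- `M`-softness: for each bounded `M`-valued function `φ` on the set of isolated points that has
positive oscillation at some point of `K`, there are a homeomorphism `g` of `K`, which fixes all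
non-isolated points, and `ε > 0` such that `φ (g x)` and `φ x` are at distance at least `ε` for
infinitely many isolated points `x`. -/
def IsMSoft (M : Type v) [MetricSpace M] (K : Type u) [TopologicalSpace K] : Prop :=
  ∀ φ : isolatedPoints K → M, Bornology.IsBounded (range φ) → (∃ z : K, 0 < osc φ z) →
    ∃ g : K ≃ₜ K, (∀ z ∉ isolatedPoints K, g z = z) ∧ ∃ ε : ℝ, 0 < ε ∧
      {x : isolatedPoints K | ε ≤ dist (φ ⟨g x, g.mem_isolatedPoints x.2⟩) (φ x)}.Infinite

/-! Let X be the set of isolated points of K and U the set of restrictions to X of continuous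
functions K → M. Separability makes X countable and properness gives |M| ≤ 𝔠, so all functions X → M
can be listed in order type 𝔠. A transfinite recursion adds one equivalence relation per stage. It
keeps every finite join finitary, keeps every f in U finitely oscillating (for each ε only finitely
many points have an ε-far equivalent point), and makes each bounded φ outside U fail this for some
join. The finite joins then form a base of a structure whose bounded slowly oscillating functions
are exactly U, and these are the functions that extend to its `M`-compactification
(`uc_toMCompactification`).

At the stage of a bounded φ ∉ U, some oscillation of φ is positive, so softness gives a
homeomorphism g fixing the non-isolated points and moving φ by at least ε infinitely often.
Functions in U are moved by a given amount only finitely often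
(`finite_dist_ge_of_fixes_nonisolated`). Identifying x with g x along a sequence therefore spoils φ
and spares U. The danger is that joins with earlier relations acquire large classes. Fewer than 𝔠 =
𝔞𝔰 joins are present, so the sequence and its image under g can be thinned until discrete for all of
them (`exists_discrete_subsequence`). The values of φ keep the two sequences apart, and
`exists_finite_sup_pairing` then controls the new joins. -/

/-! ### Finite joins of equivalence relations -/

/-- The finite joins of members of a family of equivalence relations. -/
def finiteJoins {X : Type u} (S : Set (Setoid X)) : Set (Setoid X) :=
  {E | ∃ F : Finset (Setoid X), ↑F ⊆ S ∧ E = F.sup id}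

theorem mem_finiteJoins {X : Type u} {S : Set (Setoid X)} {E : Setoid X} (hE : E ∈ S) :
    E ∈ finiteJoins S :=
  ⟨{E}, by simpa using hE, by simp⟩

theorem finiteJoins_mono {X : Type u} {S T : Set (Setoid X)} (h : S ⊆ T) :
    finiteJoins S ⊆ finiteJoins T := by
  rintro _ ⟨F, hF, rfl⟩
  exact ⟨F, hF.trans h, rfl⟩

theorem sup_mem_finiteJoins {X : Type u} {S : Set (Setoid X)} {E F : Setoid X}
    (hE : E ∈ finiteJoins S) (hF : F ∈ finiteJoins S) : E ⊔ F ∈ finiteJoins S := by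
  classical
  obtain ⟨A, hA, rfl⟩ := hE
  obtain ⟨B, hB, rfl⟩ := hF
  exact ⟨A ∪ B, by simp [hA, hB], by rw [Finset.sup_union]⟩

/-- Finitariness and finite oscillation pass to smaller relations, so after an insertion only the
joins `G ⊔ F` with `G` old need be tested. -/
theorem exists_le_sup_of_mem_finiteJoins_insert {X : Type u} {S : Set (Setoid X)}
    {E F : Setoid X} (hE : E ∈ finiteJoins (insert F S)) : ∃ G ∈ finiteJoins S, E ≤ G ⊔ F := by
  classical
  obtain ⟨A, hA, rfl⟩ := hE
  refine ⟨(A.erase F).sup id, ⟨A.erase F, ?_, rfl⟩, ?_⟩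
  · intro G hG
    have hG' := Finset.mem_erase.1 (Finset.mem_coe.1 hG)
    exact (hA hG'.2).resolve_left hG'.1
  · refine Finset.sup_le fun G hG => ?_
    by_cases h : G = F
    · subst h; exact le_sup_right
    · exact le_sup_of_le_left (Finset.le_sup (f := id) (Finset.mem_erase.2 ⟨h, hG⟩))

theorem mk_finiteJoins_le {X : Type u} (S : Set (Setoid X)) :
    #(finiteJoins S) ≤ max ℵ₀ #S := by
  classical
  have h : finiteJoins S ⊆ range fun l : List S => (l.map Subtype.val).toFinset.sup id := by
    rintro _ ⟨F, hF, rfl⟩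
    refine ⟨F.toList.attach.map fun x => ⟨x.1, hF (by simpa using x.2)⟩, ?_⟩
    simp [Function.comp_def]
  exact (mk_le_mk_of_subset h).trans (mk_range_le.trans (mk_list_le_max S))

/-! ### Finitary relations and their joins with a pairing -/

namespace Setoid

variable {X : Type u} {M : Type v} [MetricSpace M]

/-- The cardinalities of the classes are bounded by a natural number. -/
def IsFinitary (E : Setoid X) : Prop := ∃ n : ℕ, ∀ x, {y | E x y}.encard ≤ n

/-- For each `ε > 0` only finitely many points are equivalent to a point at which the value of `φ`
is `ε`-far. -/
def OscFinite (E : Setoid X) (φ : X → M) : Prop :=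
  ∀ ε : ℝ, 0 < ε → {x | ∃ y, E x y ∧ ε ≤ dist (φ x) (φ y)}.Finite

theorem IsFinitary.mono {E F : Setoid X} (hF : F.IsFinitary) (h : E ≤ F) : E.IsFinitary := by
  obtain ⟨n, hn⟩ := hF
  exact ⟨n, fun x => (encard_le_encard fun y hy => h hy).trans (hn x)⟩

theorem OscFinite.mono {E F : Setoid X} {φ : X → M} (hF : F.OscFinite φ) (h : E ≤ F) :
    E.OscFinite φ := fun ε hε => (hF ε hε).subset fun _ ⟨y, hy, hd⟩ => ⟨y, h hy, hd⟩

theorem IsFinitary.finite_class {E : Setoid X} (hE : E.IsFinitary) (x : X) :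
    {y | E x y}.Finite := by
  obtain ⟨n, hn⟩ := hE
  exact finite_of_encard_le_coe (hn x)

theorem IsFinitary.finite_saturation {E : Setoid X} (hE : E.IsFinitary) {A : Set X}
    (hA : A.Finite) : {x | ∃ a ∈ A, E x a}.Finite := by
  refine (hA.biUnion fun a _ => hE.finite_class a).subset ?_
  rintro x ⟨a, ha, hxa⟩
  exact mem_biUnion ha (E.symm hxa)

/-- The equivalence relation that identifies the points of `T`. -/
def glue (T : Finset X) : Setoid X where
  r x y := x = y ∨ x ∈ T ∧ y ∈ T
  iseqv := ⟨fun _ => Or.inl rfl, by grind, by grind⟩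

theorem glue_mono {S T : Finset X} (h : S ⊆ T) : glue S ≤ glue T := by
  intro x y hxy
  exact hxy.imp id fun h' => ⟨h h'.1, h h'.2⟩

theorem glue_isFinitary (T : Finset X) : (glue T).IsFinitary := by
  refine ⟨1 + T.card, fun x => ?_⟩
  have : {y | glue T x y} ⊆ {x} ∪ (T : Set X) := by
    intro y hy
    rcases hy with h | h
    · exact Or.inl h.symm
    · exact Or.inr h.2
  refine (encard_le_encard this).trans ((encard_union_le _ _).trans ?_)
  simp

theorem glue_oscFinite (T : Finset X) (φ : X → M) : (glue T).OscFinite φ := by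
  refine fun ε hε => T.finite_toSet.subset ?_
  rintro x ⟨y, rfl | h, hd⟩
  · simp at hd; linarith
  · exact h.1

theorem exists_le_glue {E : Setoid X} (hE : E ∈ finiteJoins (range (glue (X := X)))) :
    ∃ T, E ≤ glue T := by
  classical
  obtain ⟨F, hF, rfl⟩ := hE
  induction F using Finset.induction_on with
  | empty => exact ⟨∅, by simp⟩
  | insert a F _ ih =>
    rw [Finset.coe_insert, insert_subset_iff] at hF
    obtain ⟨T, hT⟩ := ih hF.2
    obtain ⟨T', rfl⟩ := hF.1
    refine ⟨T' ∪ T, ?_⟩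
    rw [Finset.sup_insert]
    exact sup_le (glue_mono Finset.subset_union_left)
      (hT.trans (glue_mono Finset.subset_union_right))

/-- The least equivalence relation that identifies `u n` with `v n` for all `n`. -/
def pairing (u v : ℕ → X) : Setoid X := Relation.EqvGen.setoid fun x y => ∃ n, x = u n ∧ y = v n

theorem pairing_apply (u v : ℕ → X) (n : ℕ) : pairing u v (u n) (v n) :=
  Relation.EqvGen.rel _ _ ⟨n, rfl, rfl⟩

/-- If all but finitely many `E`-classes meet `range u ∪ range v` in at most one point, then the
join of `E` and `pairing u v` can be described explicitly up to a finite set. -/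
theorem exists_finite_sup_pairing {E : Setoid X} (hE : E.IsFinitary) {u v : ℕ → X}
    (hu : {n | ∃ m ≠ n, E (u n) (u m)}.Finite) (hv : {n | ∃ m ≠ n, E (v n) (v m)}.Finite)
    (huv : {n | ∃ m, E (u n) (v m)}.Finite) (hvu : {n | ∃ m, E (v n) (u m)}.Finite) :
    ∃ A : Set ℕ, A.Finite ∧ ∃ S : Set X, S.Finite ∧
      (∀ n ∉ A, ∀ m, (E (u n) (u m) → m = n) ∧ (E (v n) (v m) → m = n)) ∧
      ∀ x y, (E ⊔ pairing u v) x y → E x y ∨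
        (∃ n ∉ A, E x (u n) ∧ E (v n) y ∨ E x (v n) ∧ E (u n) y) ∨ x ∈ S ∧ y ∈ S := by
  -- For `n ∉ A` the class of `u n` contains no `v m` and no other `u m`, and symmetrically for `v
  -- n`. The points with index in `A` are absorbed into the finite saturated set `S`.
  set A := {n | ∃ m ≠ n, E (u n) (u m)} ∪ {n | ∃ m ≠ n, E (v n) (v m)} ∪
    {n | ∃ m, E (u n) (v m)} ∪ {n | ∃ m, E (v n) (u m)} with hA
  have hAf : A.Finite := ((hu.union hv).union huv).union hvu
  have huA : ∀ n ∉ A, ∀ m, E (u n) (u m) → m = n := by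
    intro n hn m h; by_contra hne; exact hn (Or.inl (Or.inl (Or.inl ⟨m, hne, h⟩)))
  have hvA : ∀ n ∉ A, ∀ m, E (v n) (v m) → m = n := by
    intro n hn m h; by_contra hne; exact hn (Or.inl (Or.inl (Or.inr ⟨m, hne, h⟩)))
  have huvA : ∀ n ∉ A, ∀ m, ¬ E (u n) (v m) := by
    intro n hn m h; exact hn (Or.inl (Or.inr ⟨m, h⟩))
  have hvuA : ∀ n ∉ A, ∀ m, ¬ E (v n) (u m) := by
    intro n hn m h; exact hn (Or.inr ⟨m, h⟩)
  set S := {x | ∃ a ∈ u '' A ∪ v '' A, E x a} with hS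
  have hSf : S.Finite := hE.finite_saturation ((hAf.image u).union (hAf.image v))
  have hSE : ∀ x y, E x y → x ∈ S → y ∈ S := by
    rintro x y h ⟨a, ha, hxa⟩
    exact ⟨a, ha, E.trans (E.symm h) hxa⟩
  have huS : ∀ n ∉ A, u n ∉ S := by
    rintro n hn ⟨_, ⟨m, hm, rfl⟩ | ⟨m, hm, rfl⟩, h⟩
    · exact hn (huA n hn m h ▸ hm)
    · exact huvA n hn m h
  have hvS : ∀ n ∉ A, v n ∉ S := by
    rintro n hn ⟨_, ⟨m, hm, rfl⟩ | ⟨m, hm, rfl⟩, h⟩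
    · exact hvuA n hn m h
    · exact hn (hvA n hn m h ▸ hm)
  -- A path may stay in a class, cross one good pair, or live in `S`. Transitivity holds because,
  -- after crossing a good pair, the only crossing available leads back through the same pair, and
  -- `S` contains no point of a good pair.
  let H : Setoid X :=
    { r := fun x y => E x y ∨
        (∃ n ∉ A, E x (u n) ∧ E (v n) y ∨ E x (v n) ∧ E (u n) y) ∨ x ∈ S ∧ y ∈ S
      iseqv := by
        refine ⟨fun x => Or.inl (E.refl x), ?_, ?_⟩
        · rintro x y (h | ⟨n, hn, h | h⟩ | h)
          · exact Or.inl (E.symm h)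
          · exact Or.inr (Or.inl ⟨n, hn, Or.inr ⟨E.symm h.2, E.symm h.1⟩⟩)
          · exact Or.inr (Or.inl ⟨n, hn, Or.inl ⟨E.symm h.2, E.symm h.1⟩⟩)
          · exact Or.inr (Or.inr ⟨h.2, h.1⟩)
        · rintro x y z (h | ⟨n, hn, h | h⟩ | h) (k | ⟨m, hm, k | k⟩ | k)
          · exact Or.inl (E.trans h k)
          · exact Or.inr (Or.inl ⟨m, hm, Or.inl ⟨E.trans h k.1, k.2⟩⟩)
          · exact Or.inr (Or.inl ⟨m, hm, Or.inr ⟨E.trans h k.1, k.2⟩⟩)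
          · exact Or.inr (Or.inr ⟨hSE _ _ (E.symm h) k.1, k.2⟩)
          · exact Or.inr (Or.inl ⟨n, hn, Or.inl ⟨h.1, E.trans h.2 k⟩⟩)
          · exact (hvuA n hn m (E.trans h.2 k.1)).elim
          · obtain rfl := hvA n hn m (E.trans h.2 k.1)
            exact Or.inl (E.trans h.1 k.2)
          · exact (hvS n hn (hSE _ _ (E.symm h.2) k.1)).elim
          · exact Or.inr (Or.inl ⟨n, hn, Or.inr ⟨h.1, E.trans h.2 k⟩⟩)
          · obtain rfl := huA n hn m (E.trans h.2 k.1)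
            exact Or.inl (E.trans h.1 k.2)
          · exact (huvA n hn m (E.trans h.2 k.1)).elim
          · exact (huS n hn (hSE _ _ (E.symm h.2) k.1)).elim
          · exact Or.inr (Or.inr ⟨h.1, hSE _ _ k h.2⟩)
          · exact (huS m hm (hSE _ _ k.1 h.2)).elim
          · exact (hvS m hm (hSE _ _ k.1 h.2)).elim
          · exact Or.inr (Or.inr ⟨h.1, k.2⟩) }
  have hle : E ⊔ pairing u v ≤ H := by
    refine sup_le (fun x y h => Or.inl h) (Setoid.eqvGen_le ?_)
    rintro _ _ ⟨n, rfl, rfl⟩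
    by_cases hn : n ∈ A
    · exact Or.inr (Or.inr ⟨⟨u n, Or.inl ⟨n, hn, rfl⟩, E.refl _⟩,
        ⟨v n, Or.inr ⟨n, hn, rfl⟩, E.refl _⟩⟩)
    · exact Or.inr (Or.inl ⟨n, hn, Or.inl ⟨E.refl _, E.refl _⟩⟩)
  exact ⟨A, hAf, S, hSf, fun n hn m => ⟨huA n hn m, hvA n hn m⟩, fun x y h => hle h⟩

theorem IsFinitary.sup_pairing {E : Setoid X} (hE : E.IsFinitary) {u v : ℕ → X}
    (hu : {n | ∃ m ≠ n, E (u n) (u m)}.Finite) (hv : {n | ∃ m ≠ n, E (v n) (v m)}.Finite)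
    (huv : {n | ∃ m, E (u n) (v m)}.Finite) (hvu : {n | ∃ m, E (v n) (u m)}.Finite) :
    (E ⊔ pairing u v).IsFinitary := by
  obtain ⟨A, -, S, hS, hA, hsub⟩ := exists_finite_sup_pairing hE hu hv huv hvu
  obtain ⟨k, hk⟩ := hE
  obtain ⟨s, hs⟩ := hS.exists_encard_eq_coe
  refine ⟨k + (k + k) + s, fun x => ?_⟩
  -- At most one good index has `u n` in the class of `x`, so there is a single partner `a`; if
  -- there is none, `x` is a harmless default. The class of `x` in the join is then covered by three
  -- `E`-classes and `S`.
  have h1 : ∃ a, ∀ n ∉ A, E x (u n) → v n = a := by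
    by_cases h : ∃ n ∉ A, E x (u n)
    · obtain ⟨n, hn, hxn⟩ := h
      exact ⟨v n, fun m _ hxm => by rw [(hA n hn m).1 (E.trans (E.symm hxn) hxm)]⟩
    · push Not at h
      exact ⟨x, fun n hn hx => (h n hn hx).elim⟩
  have h2 : ∃ b, ∀ n ∉ A, E x (v n) → u n = b := by
    by_cases h : ∃ n ∉ A, E x (v n)
    · obtain ⟨n, hn, hxn⟩ := h
      exact ⟨u n, fun m _ hxm => by rw [(hA n hn m).2 (E.trans (E.symm hxn) hxm)]⟩
    · push Not at h
      exact ⟨x, fun n hn hx => (h n hn hx).elim⟩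
  obtain ⟨a, ha⟩ := h1
  obtain ⟨b, hb⟩ := h2
  have hcover : {y | (E ⊔ pairing u v) x y} ⊆
      {y | E x y} ∪ ({y | E a y} ∪ {y | E b y}) ∪ S := by
    intro y hy
    rcases hsub x y hy with h | ⟨n, hn, h | h⟩ | h
    · exact Or.inl (Or.inl h)
    · exact Or.inl (Or.inr (Or.inl (ha n hn h.1 ▸ h.2)))
    · exact Or.inl (Or.inr (Or.inr (hb n hn h.1 ▸ h.2)))
    · exact Or.inr h.2
  refine (encard_le_encard hcover).trans ((encard_union_le _ _).trans ?_)
  push_cast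
  refine add_le_add ((encard_union_le _ _).trans (add_le_add (hk x)
    ((encard_union_le _ _).trans (add_le_add (hk a) (hk b))))) hs.le

/-- A jump of size ε along x ~ u n, v n ~ y (or the reverse crossing) forces a jump of ε/3 on one of
its three legs, and each leg can do so only finitely often. -/
theorem OscFinite.sup_pairing {E : Setoid X} (hE : E.IsFinitary) {u v : ℕ → X}
    (hu : {n | ∃ m ≠ n, E (u n) (u m)}.Finite) (hv : {n | ∃ m ≠ n, E (v n) (v m)}.Finite)
    (huv : {n | ∃ m, E (u n) (v m)}.Finite) (hvu : {n | ∃ m, E (v n) (u m)}.Finite)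
    {φ : X → M} (hφ : E.OscFinite φ)
    (hφuv : ∀ ε : ℝ, 0 < ε → {n | ε ≤ dist (φ (u n)) (φ (v n))}.Finite) :
    (E ⊔ pairing u v).OscFinite φ := by
  obtain ⟨A, -, S, hS, -, hsub⟩ := exists_finite_sup_pairing hE hu hv huv hvu
  intro ε hε
  have hε3 : 0 < ε / 3 := by positivity
  set B := {x | ∃ y, E x y ∧ ε / 3 ≤ dist (φ x) (φ y)} with hB
  have hBf : B.Finite := hφ _ hε3
  have hBs : ∀ x y, E x y → ε / 3 ≤ dist (φ x) (φ y) → y ∈ B := fun x y h hd =>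
    ⟨x, E.symm h, by rwa [dist_comm]⟩
  set N := {n | ε / 3 ≤ dist (φ (u n)) (φ (v n))} with hN
  have hNf : N.Finite := hφuv _ hε3
  -- Finitely many points lie near `B`. To get finitely many indices, note that `w` is injective off
  -- the indices whose class contains another term.
  have hfar : ∀ w : ℕ → X, {n | ∃ m ≠ n, E (w n) (w m)}.Finite →
      {n | w n ∈ {x | ∃ a ∈ B, E x a}}.Finite := by
    intro w hw
    have hC := hE.finite_saturation hBf
    by_contra hinf
    have hinf' : ({n | w n ∈ {x | ∃ a ∈ B, E x a}} \ {n | ∃ m ≠ n, E (w n) (w m)}).Infinite :=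
      Set.Infinite.sdiff hinf hw
    refine hinf' (Set.Finite.of_finite_image (hC.subset ?_) (f := w) ?_)
    · rintro _ ⟨n, hn, rfl⟩; exact hn.1
    · intro n hn m hm h
      by_contra hne
      exact hn.2 ⟨m, fun h => hne h.symm, by rw [h]⟩
  set N' := N ∪ {n | u n ∈ {x | ∃ a ∈ B, E x a}} ∪ {n | v n ∈ {x | ∃ a ∈ B, E x a}} with hN'
  have hNf' : N'.Finite := (hNf.union (hfar u hu)).union (hfar v hv)
  refine ((hBf.union hS).union
    (hE.finite_saturation ((hNf'.image u).union (hNf'.image v)))).subset ?_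
  rintro x ⟨y, hxy, hd⟩
  rcases hsub x y hxy with h | ⟨n, -, h | h⟩ | h
  · exact Or.inl (Or.inl ⟨y, h, by linarith⟩)
  · by_cases h1 : ε / 3 ≤ dist (φ x) (φ (u n))
    · exact Or.inl (Or.inl ⟨_, h.1, h1⟩)
    by_cases hn : n ∈ N'
    · exact Or.inr ⟨u n, Or.inl ⟨n, hn, rfl⟩, h.1⟩
    exfalso
    have h2 : ¬ ε / 3 ≤ dist (φ (u n)) (φ (v n)) := fun h2 =>
      hn (Or.inl (Or.inl h2))
    have h3 : ¬ ε / 3 ≤ dist (φ (v n)) (φ y) := fun h3 =>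
      hn (Or.inr ⟨v n, ⟨y, h.2, h3⟩, E.refl _⟩)
    have := dist_triangle4 (φ x) (φ (u n)) (φ (v n)) (φ y)
    linarith
  · by_cases h1 : ε / 3 ≤ dist (φ x) (φ (v n))
    · exact Or.inl (Or.inl ⟨_, h.1, h1⟩)
    by_cases hn : n ∈ N'
    · exact Or.inr ⟨v n, Or.inr ⟨n, hn, rfl⟩, h.1⟩
    exfalso
    have h2 : ¬ ε / 3 ≤ dist (φ (v n)) (φ (u n)) := fun h2 =>
      hn (Or.inl (Or.inl (by rwa [dist_comm] at h2)))
    have h3 : ¬ ε / 3 ≤ dist (φ (u n)) (φ y) := fun h3 =>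
      hn (Or.inl (Or.inr ⟨u n, ⟨y, h.2, h3⟩, E.refl _⟩))
    have := dist_triangle4 (φ x) (φ (v n)) (φ (u n)) (φ y)
    linarith
  · exact Or.inl (Or.inr h.1)

end Setoid

/-! ### Coarse structures generated by equivalence relations -/

namespace CoarseStructure

variable {X : Type u}

/-- The coarse structure with a given base of equivalence relations. -/
def ofSetoids (B : Set (Setoid X)) (hdir : ∀ s ∈ B, ∀ t ∈ B, ∃ r ∈ B, s ⊔ t ≤ r)
    (hcov : ∀ x y, ∃ s ∈ B, s x y) : CoarseStructure X where
  entourages := {E | (∀ x, (x, x) ∈ E) ∧ ∃ s ∈ B, ∀ x y, (x, y) ∈ E → s x y}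
  diag_mem := fun E hE => hE.1
  sUnion_eq := by
    refine eq_univ_of_forall fun ⟨x, y⟩ => ?_
    obtain ⟨s, hs, hxy⟩ := hcov x y
    exact ⟨{p | s p.1 p.2}, ⟨fun x => s.refl x, s, hs, fun _ _ h => h⟩, hxy⟩
  comp_inv := by
    rintro E ⟨hE, s, hs, hEs⟩ F ⟨hF, t, ht, hFt⟩
    obtain ⟨r, hr, hst⟩ := hdir s hs t ht
    refine ⟨{p | r p.1 p.2}, ⟨fun x => r.refl x, r, hr, fun _ _ h => h⟩, ?_⟩
    rintro ⟨x, z⟩ ⟨y, hxy, hyz⟩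
    exact r.trans (hst ((le_sup_left : s ≤ s ⊔ t) (hEs _ _ hxy)))
      (r.symm (hst ((le_sup_right : t ≤ s ⊔ t) (hFt _ _ hyz))))
  down_closed := by
    rintro E F hE hEF ⟨-, s, hs, hFs⟩
    exact ⟨hE, s, hs, fun x y h => hFs x y (hEF h)⟩

section
variable {B : Set (Setoid X)} {hdir : ∀ s ∈ B, ∀ t ∈ B, ∃ r ∈ B, s ⊔ t ≤ r}
    {hcov : ∀ x y, ∃ s ∈ B, s x y}

theorem setoid_mem_ofSetoids {s : Setoid X} (hs : s ∈ B) :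
    ({p | s p.1 p.2} : SetRel X X) ∈ (ofSetoids B hdir hcov).entourages :=
  ⟨fun x => s.refl x, s, hs, fun _ _ h => h⟩

theorem isBase_ofSetoids : (ofSetoids B hdir hcov).IsBase
    ((fun s : Setoid X => ({p | s p.1 p.2} : SetRel X X)) '' B) := by
  refine ⟨?_, ?_⟩
  · rintro _ ⟨s, hs, rfl⟩
    exact setoid_mem_ofSetoids hs
  · rintro E ⟨-, s, hs, hEs⟩
    exact ⟨_, ⟨s, hs, rfl⟩, fun p hp => hEs p.1 p.2 hp⟩

theorem isCellular_ofSetoids : (ofSetoids B hdir hcov).IsCellular := by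
  refine ⟨_, isBase_ofSetoids, ?_⟩
  rintro _ ⟨s, -, rfl⟩
  exact s.iseqv

theorem isFinitary_ofSetoids (h : ∀ s ∈ B, s.IsFinitary) : (ofSetoids B hdir hcov).IsFinitary := by
  rintro E ⟨-, s, hs, hEs⟩
  obtain ⟨n, hn⟩ := h s hs
  exact ⟨n, fun x => (encard_le_encard fun y hy => hEs x y hy).trans (hn x)⟩

end

theorem IsFinitary.finite_of_isBounded {C : CoarseStructure X} (hC : C.IsFinitary) {A : Set X}
    (hA : C.IsBounded A) : A.Finite := by
  obtain ⟨E, hE, x, hAx⟩ := hA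
  obtain ⟨n, hn⟩ := hC E hE
  exact finite_of_encard_le_coe ((encard_le_encard hAx).trans (hn x))

theorem exists_mem_entourages (C : CoarseStructure X) (x y : X) :
    ∃ E ∈ C.entourages, (x, y) ∈ E := by
  have : (x, y) ∈ ⋃₀ C.entourages := by rw [C.sUnion_eq]; trivial
  exact this

theorem isBounded_of_finite [Nonempty X] (C : CoarseStructure X) {A : Set X} (hA : A.Finite) :
    C.IsBounded A := by
  obtain ⟨x⟩ := ‹Nonempty X›
  suffices h : ∃ E ∈ C.entourages, A ⊆ entBall E x by
    obtain ⟨E, hE, h⟩ := h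
    exact ⟨E, hE, x, h⟩
  induction A, hA using Set.Finite.induction_on with
  | empty =>
    obtain ⟨E, hE, -⟩ := C.exists_mem_entourages x x
    exact ⟨E, hE, empty_subset _⟩
  | @insert a A _ _ ih =>
    obtain ⟨E, hE, hA⟩ := ih
    obtain ⟨F, hF, ha⟩ := C.exists_mem_entourages a x
    obtain ⟨G, hG, hEG⟩ := C.comp_inv E hE F hF
    refine ⟨G, hG, ?_⟩
    rintro y (rfl | hy)
    · exact hEG ⟨x, C.diag_mem E hE x, ha⟩
    · exact hEG ⟨y, hA hy, C.diag_mem F hF y⟩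

/-- In a nonempty finitary space the bounded sets are exactly the finite ones. Diameters of balls
are compared with distances from the centre, at the cost of a factor 2. -/
theorem IsFinitary.slowlyOscillating_iff [Nonempty X] {C : CoarseStructure X} (hC : C.IsFinitary)
    {M : Type v} [MetricSpace M] {φ : X → M} :
    C.SlowlyOscillating φ ↔ ∀ E ∈ C.entourages, ∀ ε : ℝ, 0 < ε →
      {x | ∃ y, (x, y) ∈ E ∧ ε ≤ dist (φ x) (φ y)}.Finite := by
  constructor
  · intro h E hE ε hε
    obtain ⟨A, hA, hAE⟩ := h ε hε E hE
    refine (hC.finite_of_isBounded hA).subset ?_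
    rintro x ⟨y, hxy, hd⟩
    by_contra hx
    have h1 := hAE x hx
    have h2 := Metric.edist_le_ediam_of_mem (mem_image_of_mem φ (C.diag_mem E hE x :
      x ∈ entBall E x)) (mem_image_of_mem φ (show y ∈ entBall E x from hxy))
    have h3 := h2.trans_lt h1
    rw [edist_dist, ENNReal.ofReal_lt_ofReal_iff hε] at h3
    linarith
  · intro h ε hε E hE
    have hε3 : 0 < ε / 3 := by positivity
    refine ⟨_, C.isBounded_of_finite (h E hE _ hε3), fun x hx => ?_⟩
    have hx' : ∀ y, (x, y) ∈ E → dist (φ x) (φ y) < ε / 3 := by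
      intro y hy
      by_contra hd
      exact hx ⟨y, hy, not_lt.1 hd⟩
    refine lt_of_le_of_lt (Metric.ediam_le (d := ENNReal.ofReal (2 * (ε / 3))) ?_) ?_
    · rintro _ ⟨y, hy, rfl⟩ _ ⟨z, hz, rfl⟩
      rw [edist_dist]
      apply ENNReal.ofReal_le_ofReal
      have := dist_triangle_left (φ y) (φ z) (φ x)
      linarith [hx' y hy, hx' z hz]
    · rw [ENNReal.ofReal_lt_ofReal_iff hε]
      linarith

end CoarseStructure

/-! ### Adding one relation -/

namespace Setoid

variable {X : Type u} {M : Type v} [MetricSpace M]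

/-- Below the cardinal `𝔞𝔰`, every sequence has a subsequence that is discrete with respect to all
finite joins of a family of equivalence relations. -/
theorem exists_discrete_subsequence {S : Set (Setoid X)} (hS : range glue ⊆ S)
    (hfin : ∀ E ∈ finiteJoins S, E.IsFinitary)
    (hcard : lift.{0} #(finiteJoins S) < lift.{u} cardinalAS)
    {e : ℕ → X} (he : Function.Injective e) :
    ∃ N : ℕ → ℕ, Function.Injective N ∧
      ∀ E ∈ finiteJoins S, {n | ∃ m ≠ n, E (e (N n)) (e (N m))}.Finite := by
  classical
  -- Pulled back along `e`, the joins form a base on `ℕ` of fewer than `𝔞𝔰` finitary relations, so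
  -- the resulting structure has an infinite discrete subset.
  set B : Set (Setoid ℕ) := Setoid.comap e '' finiteJoins S with hB
  have hdir : ∀ s ∈ B, ∀ t ∈ B, ∃ r ∈ B, s ⊔ t ≤ r := by
    rintro _ ⟨s, hs, rfl⟩ _ ⟨t, ht, rfl⟩
    refine ⟨_, ⟨s ⊔ t, sup_mem_finiteJoins hs ht, rfl⟩, sup_le ?_ ?_⟩
    · exact fun x y h => (le_sup_left : s ≤ s ⊔ t) h
    · exact fun x y h => (le_sup_right : t ≤ s ⊔ t) h
  have hcov : ∀ x y, ∃ s ∈ B, s x y := by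
    intro x y
    refine ⟨_, ⟨glue {e x, e y}, mem_finiteJoins (hS ⟨_, rfl⟩), rfl⟩, ?_⟩
    exact Or.inr (by simp)
  set C := CoarseStructure.ofSetoids B hdir hcov with hC
  have hCfin : C.IsFinitary := by
    refine CoarseStructure.isFinitary_ofSetoids ?_
    rintro _ ⟨s, hs, rfl⟩
    obtain ⟨n, hn⟩ := hfin s hs
    refine ⟨n, fun x => ?_⟩
    rw [← he.encard_image]
    refine (encard_le_encard ?_).trans (hn (e x))
    rintro _ ⟨y, hy, rfl⟩
    exact hy
  have hdisc : ∃ D : Set ℕ, D.Infinite ∧ C.IsDiscreteSubset D := by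
    by_contra hno
    push Not at hno
    have hle : cardinalAS ≤ #((fun s : Setoid ℕ => ({p | s p.1 p.2} : SetRel ℕ ℕ)) '' B) :=
      csInf_le' ⟨C, CoarseStructure.isCellular_ofSetoids, hCfin, hno, _,
        CoarseStructure.isBase_ofSetoids, rfl⟩
    have h1 : cardinalAS ≤ #B := hle.trans mk_image_le
    have h2 : lift.{u} #B ≤ lift.{0} #(finiteJoins S) := mk_image_le_lift
    exact absurd (lift_le.{u}.2 h1) (not_le.2 (h2.trans_lt hcard))
  obtain ⟨D, hD, hdisc⟩ := hdisc
  refine ⟨fun n => (hD.natEmbedding D n : ℕ),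
    Subtype.val_injective.comp (hD.natEmbedding D).injective, fun E hE => ?_⟩
  obtain ⟨A, hA, hAD⟩ := hdisc {p | E (e p.1) (e p.2)}
    (CoarseStructure.setoid_mem_ofSetoids (s := Setoid.comap e E) ⟨E, hE, rfl⟩)
  refine Set.Finite.subset ((hCfin.finite_of_isBounded hA).preimage (f := fun n =>
    (hD.natEmbedding D n : ℕ))
    (Subtype.val_injective.comp (hD.natEmbedding D).injective).injOn) ?_
  rintro n ⟨m, hmn, h⟩
  by_contra hn
  have h1 := hAD _ ⟨(hD.natEmbedding D n).2, hn⟩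
  have h2 : (hD.natEmbedding D m : ℕ) ∈ D ∩ entBall {p | E (e p.1) (e p.2)}
    (hD.natEmbedding D n : ℕ) := ⟨(hD.natEmbedding D m).2, h⟩
  rw [h1] at h2
  exact hmn ((Subtype.val_injective.comp (hD.natEmbedding D).injective) h2)

end Setoid

/-- A bounded function that is moved by at least `ε` at infinitely many points by an injective map
admits a sequence of points along which its values are uniformly apart from the values at all moved
points. -/
theorem exists_seq_dist_ge {X : Type u} {M : Type v} [MetricSpace M] [ProperSpace M] {φ : X → M}
    (hφ : Bornology.IsBounded (range φ)) (g : X → X) {ε : ℝ} (hε : 0 < ε)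
    (hinf : {x | ε ≤ dist (φ (g x)) (φ x)}.Infinite) :
    ∃ e : ℕ → X, Function.Injective e ∧ ∃ δ : ℝ, 0 < δ ∧
      ∀ n m, δ ≤ dist (φ (e n)) (φ (g (e m))) := by
  set e₀ := hinf.natEmbedding _ with he₀
  have hb : Bornology.IsBounded (range φ ×ˢ range φ) := hφ.prod hφ
  obtain ⟨⟨a, b⟩, -, ψ, hψ, hlim⟩ := tendsto_subseq_of_bounded hb
    (x := fun n => (φ (e₀ n), φ (g (e₀ n)))) (fun n => ⟨mem_range_self _, mem_range_self _⟩)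
  have hla : Filter.Tendsto (fun n => φ (e₀ (ψ n))) Filter.atTop (𝓝 a) :=
    (continuous_fst.tendsto _).comp hlim
  have hlb : Filter.Tendsto (fun n => φ (g (e₀ (ψ n)))) Filter.atTop (𝓝 b) :=
    (continuous_snd.tendsto _).comp hlim
  have hab : ε ≤ dist b a := ge_of_tendsto' (hlb.dist hla) fun n => (e₀ (ψ n)).2
  -- The limits `a`, `b` are at least `ε` apart, so terms within `ε / 4` of them stay `ε / 2` apart,
  -- whatever their indices.
  have hε4 : 0 < ε / 4 := by positivity
  obtain ⟨k, hk⟩ := Filter.eventually_atTop.1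
    ((hla.eventually (Metric.ball_mem_nhds a hε4)).and
      (hlb.eventually (Metric.ball_mem_nhds b hε4)))
  refine ⟨fun n => e₀ (ψ (k + n)), ?_, ε / 2, by positivity, fun n m => ?_⟩
  · intro n m h
    have := hψ.injective (e₀.injective (Subtype.val_injective h))
    omega
  · have h1 := Metric.mem_ball'.1 (hk (k + n) (by omega)).1
    have h2 := Metric.mem_ball.1 (hk (k + m) (by omega)).2
    have := dist_triangle4 b (φ (g (e₀ (ψ (k + m))))) (φ (e₀ (ψ (k + n)))) a
    rw [dist_comm b (φ _), dist_comm (φ (e₀ _)) a, dist_comm (φ (g _)) (φ (e₀ _))] at this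
    simp only
    linarith

namespace Setoid

variable {X : Type u} {M : Type v} [MetricSpace M]

/-- All finite joins of members of `S` are finitary, and the functions from `U` oscillate finitely
with respect to them. -/
def IsAdmissible (U : Set (X → M)) (S : Set (Setoid X)) : Prop :=
  ∀ E ∈ finiteJoins S, E.IsFinitary ∧ ∀ f ∈ U, E.OscFinite f

/-- This is the starting family of the recursion: it relates any two points, as a coarse structure
must, yet disturbs only finitely many points per join. -/
theorem isAdmissible_range_glue (U : Set (X → M)) : IsAdmissible U (range glue) := by
  intro E hE
  obtain ⟨T, hT⟩ := exists_le_glue hE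
  exact ⟨(glue_isFinitary T).mono hT, fun f _ => (glue_oscFinite T f).mono hT⟩

theorem isAdmissible_of_finset {U : Set (X → M)} {S : Set (Setoid X)}
    (h : ∀ F : Finset (Setoid X), ↑F ⊆ S → IsAdmissible U (F : Set (Setoid X))) :
    IsAdmissible U S := by
  rintro _ ⟨F, hF, rfl⟩
  exact h F hF _ ⟨F, Subset.rfl, rfl⟩

theorem IsAdmissible.mono {U : Set (X → M)} {S T : Set (Setoid X)} (hT : IsAdmissible U T)
    (h : S ⊆ T) : IsAdmissible U S := fun E hE => hT E (finiteJoins_mono h hE)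

/-- A small admissible family can be enlarged by one equivalence relation in such a way that a
given function, which is essentially moved by a suitable map `g`, does not oscillate finitely. -/
theorem IsAdmissible.exists_insert [ProperSpace M] {U : Set (X → M)} {S : Set (Setoid X)}
    (hU : IsAdmissible U S) (hS : range glue ⊆ S)
    (hcard : lift.{0} #(finiteJoins S) < lift.{u} cardinalAS)
    {φ : X → M} (hφ : Bornology.IsBounded (range φ)) {g : X → X} (hg : Function.Injective g)
    {ε : ℝ} (hε : 0 < ε) (hinf : {x | ε ≤ dist (φ (g x)) (φ x)}.Infinite)
    (hgU : ∀ f ∈ U, ∀ δ : ℝ, 0 < δ → {x | δ ≤ dist (f (g x)) (f x)}.Finite) :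
    ∃ F, IsAdmissible U (insert F S) ∧ ∃ E ∈ finiteJoins (insert F S), ¬ E.OscFinite φ := by
  -- If some old join already spoils `φ`, the old member `glue ∅` is inserted and nothing changes.
  -- Otherwise the finite oscillation of `φ` is what separates `u` from its image in `h3` and `h4`.
  by_cases hosc : ∀ E ∈ finiteJoins S, E.OscFinite φ
  swap
  · push Not at hosc
    refine ⟨glue ∅, ?_⟩
    rw [insert_eq_of_mem (hS ⟨∅, rfl⟩)]
    exact ⟨hU, hosc⟩
  obtain ⟨e, he, δ, hδ, hsep⟩ := exists_seq_dist_ge hφ g hε hinf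
  have hfin : ∀ E ∈ finiteJoins S, E.IsFinitary := fun E hE => (hU E hE).1
  -- The first thinning makes the points discrete, the second their images under `g`; the first
  -- property survives passing to a subsequence.
  obtain ⟨N, hN, hNd⟩ := exists_discrete_subsequence hS hfin hcard he
  obtain ⟨N', hN', hNd'⟩ := exists_discrete_subsequence hS hfin hcard
    (hg.comp (he.comp hN))
  set u : ℕ → X := fun n => e (N (N' n)) with hu
  have hui : Function.Injective u := he.comp (hN.comp hN')
  have hvi : Function.Injective fun n => g (u n) := hg.comp hui
  refine ⟨pairing u fun n => g (u n), ?_, pairing u fun n => g (u n),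
    mem_finiteJoins (mem_insert _ _), ?_⟩
  · intro E hE
    obtain ⟨G, hG, hEG⟩ := exists_le_sup_of_mem_finiteJoins_insert hE
    have h1 : {n | ∃ m ≠ n, G (u n) (u m)}.Finite := by
      refine ((hNd G hG).preimage hN'.injOn).subset ?_
      rintro n ⟨m, hmn, h⟩
      exact ⟨N' m, fun h' => hmn (hN' h'), h⟩
    have h2 : {n | ∃ m ≠ n, G (g (u n)) (g (u m))}.Finite := hNd' G hG
    have h3 : {n | ∃ m, G (u n) (g (u m))}.Finite := by
      refine ((hosc G hG δ hδ).preimage hui.injOn).subset ?_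
      rintro n ⟨m, h⟩
      exact ⟨_, h, hsep _ _⟩
    have h4 : {n | ∃ m, G (g (u n)) (u m)}.Finite := by
      refine ((hosc G hG δ hδ).preimage hvi.injOn).subset ?_
      rintro n ⟨m, h⟩
      exact ⟨_, h, by rw [dist_comm]; exact hsep _ _⟩
    refine ⟨((hfin G hG).sup_pairing h1 h2 h3 h4).mono hEG, fun f hf => ?_⟩
    refine (((hU G hG).2 f hf).sup_pairing (hfin G hG) h1 h2 h3 h4 fun η hη => ?_).mono hEG
    refine ((hgU f hf η hη).preimage hui.injOn).subset fun n hn => ?_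
    simpa [dist_comm] using hn
  · intro h
    refine infinite_range_of_injective hui ((h δ hδ).subset ?_)
    rintro _ ⟨n, rfl⟩
    exact ⟨_, pairing_apply _ _ n, hsep _ _⟩

end Setoid

/-! ### Transfinite recursion -/

/-- Transfinite extension of a family with a property of finite character. -/
theorem exists_superset_of_finite_character {α : Type u} [Nonempty α] {ι : Type v} [LinearOrder ι]
    [WellFoundedLT ι] (P : Set α → Prop) (hPmono : ∀ S T, S ⊆ T → P T → P S)
    (hPfin : ∀ S, (∀ F : Finset α, ↑F ⊆ S → P ↑F) → P S) {S₀ : Set α} (h₀ : P S₀)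
    (Q : ι → Set α → Prop) (hQ : ∀ i S T, S ⊆ T → Q i S → Q i T)
    (step : ∀ i (f : Iio i → α), P (S₀ ∪ range f) →
      ∃ a, P (insert a (S₀ ∪ range f)) ∧ Q i (insert a (S₀ ∪ range f))) :
    ∃ S, S₀ ⊆ S ∧ P S ∧ ∀ i, Q i S := by
  classical
  -- The choice is made total, with an arbitrary value when `P` fails, so that the recursion need
  -- not carry `P`; `P` is recovered afterwards by induction.
  have step' : ∀ i (f : Iio i → α), ∃ a, P (S₀ ∪ range f) →
      P (insert a (S₀ ∪ range f)) ∧ Q i (insert a (S₀ ∪ range f)) := by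
    intro i f
    by_cases h : P (S₀ ∪ range f)
    · obtain ⟨a, ha⟩ := step i f h
      exact ⟨a, fun _ => ha⟩
    · exact ⟨Classical.arbitrary α, fun h' => (h h').elim⟩
  choose next hnext using step'
  let G : ι → α := (wellFounded_lt (α := ι)).fix fun i ih => next i fun j => ih j.1 j.2
  have hG : ∀ i, G i = next i fun j => G j.1 := fun i => WellFounded.fix_eq _ _ _
  set R : ι → Set α := fun i => S₀ ∪ range fun j : Iio i => G j.1 with hR
  have hins : ∀ i, insert (G i) (R i) = S₀ ∪ G '' Iic i := by
    intro i
    have h1 : (range fun j : Iio i => G j.1) = G '' Iio i := by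
      rw [image_eq_range]
    rw [hR]
    simp only [h1]
    rw [← Iio_insert, image_insert_eq, union_insert]
  -- A finite subset uses finitely many stages, hence lies below the largest of them. This covers
  -- every initial segment and the final union alike.
  have hfc : ∀ J : Set ι, (∀ j ∈ J, P (S₀ ∪ G '' Iic j)) → P (S₀ ∪ G '' J) := by
    intro J hJ
    refine hPfin _ fun F hF => ?_
    have : ∃ s : Finset ι, ↑s ⊆ J ∧ (F : Set α) ⊆ S₀ ∪ G '' s := by
      have hfs : ((F : Set α) \ S₀).Finite := F.finite_toSet.subset sdiff_subset
      have hsub : (F : Set α) \ S₀ ⊆ G '' J := fun x hx => (hF hx.1).resolve_left hx.2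
      obtain ⟨s, hsJ, hs⟩ := Finset.subset_set_image_iff.1
        (show (hfs.toFinset : Set α) ⊆ G '' J by rwa [hfs.coe_toFinset])
      refine ⟨s, hsJ, fun x hx => ?_⟩
      by_cases hx0 : x ∈ S₀
      · exact Or.inl hx0
      · right
        have : x ∈ hfs.toFinset := by simpa using ⟨hx, hx0⟩
        rw [← hs] at this
        simpa using this
    obtain ⟨s, hsJ, hFs⟩ := this
    rcases s.eq_empty_or_nonempty with rfl | hne
    · exact hPmono _ _ (by simpa using hFs) h₀
    · refine hPmono _ _ (hFs.trans (union_subset_union_right _ (image_mono ?_)))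
        (hJ (s.max' hne) (hsJ (s.max'_mem hne)))
      exact fun x hx => s.le_max' x hx
  have hP : ∀ i, P (insert (G i) (R i)) ∧ Q i (insert (G i) (R i)) := by
    intro i
    induction i using WellFoundedLT.induction with
    | ind i ih =>
      have : P (R i) := by
        have h := hfc (Iio i) fun j hj => hins j ▸ (ih j hj).1
        rwa [image_eq_range] at h
      rw [hG i]
      exact hnext i _ this
  refine ⟨S₀ ∪ range G, subset_union_left, ?_, fun i => ?_⟩
  · rw [← image_univ]
    exact hfc univ fun j _ => hins j ▸ (hP j).1
  · refine hQ i _ _ ?_ (hP i).2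
    rw [hins]
    exact union_subset_union_right _ (image_subset_range _ _)

/-! ### The `M`-compactification of a finitary space -/

namespace CoarseStructure

variable {X : Type u} {C : CoarseStructure X} {M : Type v} [MetricSpace M]

theorem denseRange_toMCompactification : DenseRange (C.toMCompactification M) := by
  rintro ⟨p, hp⟩
  rw [closure_subtype, ← range_comp]
  exact hp

instance compactSpace_mCompactification [ProperSpace M] :
    CompactSpace (C.MCompactification M) := by
  rw [← isCompact_iff_compactSpace]
  refine (isCompact_univ_pi fun f : C.so M => f.2.1.isCompact_closure).of_isClosed_subset
    isClosed_closure (closure_minimal ?_ ?_)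
  · rintro _ ⟨x, rfl⟩ f -
    exact subset_closure (mem_range_self x)
  · exact isClosed_set_pi fun _ _ => isClosed_closure

theorem IsFinitary.finite_mem (hC : C.IsFinitary) {E : SetRel X X} (hE : E ∈ C.entourages)
    (x : X) : {y | (x, y) ∈ E}.Finite := by
  obtain ⟨n, hn⟩ := hC E hE
  exact finite_of_encard_le_coe (hn x)

theorem IsFinitary.finite_mem_inv (hC : C.IsFinitary) {E : SetRel X X} (hE : E ∈ C.entourages)
    (x : X) : {y | (y, x) ∈ E}.Finite := by
  obtain ⟨G, hG, hEG⟩ := C.comp_inv E hE E hE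
  exact (hC.finite_mem hG x).subset fun y hy => hEG ⟨x, C.diag_mem E hE x, hy⟩

/-- Jumps occur only at `x` and at points whose ball contains `x`, and there are finitely many of
these. Such functions isolate `x` in the compactification. -/
theorem IsFinitary.update_const_mem_so [DecidableEq X] (hC : C.IsFinitary) (x : X) (a b : M) :
    Function.update (fun _ => b) x a ∈ C.so M := by
  have : Nonempty X := ⟨x⟩
  refine ⟨(Set.toFinite {a, b}).isBounded.subset ?_, ?_⟩
  · rintro _ ⟨y, rfl⟩
    by_cases h : y = x
    · subst h; simp
    · simp [Function.update_of_ne h]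
  · rw [hC.slowlyOscillating_iff]
    intro E hE ε hε
    refine ((finite_singleton x).union (hC.finite_mem_inv hE x)).subset ?_
    rintro y ⟨z, hyz, hd⟩
    by_contra h
    have hy : y ≠ x := fun h' => h (Or.inl h')
    have hz : z ≠ x := fun h' => h (Or.inr (h' ▸ hyz))
    rw [Function.update_of_ne hy, Function.update_of_ne hz, dist_self] at hd
    linarith

theorem IsFinitary.isCompactificationOf [ProperSpace M] [Nontrivial M] (hC : C.IsFinitary) :
    IsCompactificationOf (C.toMCompactification M) := by
  classical
  obtain ⟨a, b, hab⟩ := exists_pair_ne M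
  have hval : ∀ (f : C.so M) (x : X), (C.toMCompactification M x).1 f = f.1 x := fun _ _ => rfl
  let φ : X → C.so M := fun x => ⟨_, hC.update_const_mem_so x a b⟩
  have hinj : Function.Injective (C.toMCompactification M) := by
    intro x y h
    by_contra hne
    have := congrArg (fun p : C.MCompactification M => p.1 (φ x)) h
    simp only [hval, φ, Function.update_self, Function.update_of_ne (Ne.symm hne)] at this
    exact hab this
  have hiso : range (C.toMCompactification M) ⊆ isolatedPoints (C.MCompactification M) := by
    rintro _ ⟨x, rfl⟩
    set U : Set (C.MCompactification M) := {p | p.1 (φ x) ≠ b} with hU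
    have hUo : IsOpen U :=
      isOpen_ne.preimage ((continuous_apply (φ x)).comp continuous_subtype_val)
    -- An open set meeting the dense image of `X` in one point lies in the closure of that point,
    -- hence equals it.
    have hUr : U ∩ range (C.toMCompactification M) ⊆ {C.toMCompactification M x} := by
      rintro _ ⟨hp, y, rfl⟩
      by_contra hne
      have hyx : y ≠ x := fun h => hne (by rw [h]; rfl)
      exact hp (show Function.update (fun _ => b) x a y = b by simp [hyx])
    have hUx : U = {C.toMCompactification M x} := by
      refine Subset.antisymm ?_ ?_
      · refine (denseRange_toMCompactification.open_subset_closure_inter hUo).trans ?_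
        exact (closure_mono hUr).trans closure_singleton.subset
      · rintro _ rfl
        change (φ x).1 x ≠ b
        simpa [φ] using hab
    rw [hUx] at hUo
    exact hUo
  refine ⟨⟨inferInstance, inferInstance, denseRange_toMCompactification.mono hiso⟩, hinj,
    Subset.antisymm hiso ?_⟩
  intro p hp
  obtain ⟨_, rfl, h⟩ := denseRange_toMCompactification.inter_open_nonempty _ hp ⟨p, rfl⟩
  exact h

/-- A slowly oscillating function extends as a coordinate projection. Conversely, if a continuous
`f` jumped by ε between infinitely many `x` and partners `y x`, a nonprincipal ultrafilter on these
`x` would give limits `p` and `q`. All coordinates of `p` and `q` agree by slow oscillation, so `p =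
q`, while `f p` and `f q` are ε apart. -/
theorem IsFinitary.uc_toMCompactification [Nonempty X] [ProperSpace M] (hC : C.IsFinitary) :
    uc (C.toMCompactification M) M = C.so M := by
  refine Subset.antisymm ?_ ?_
  · rintro φ ⟨f, hf⟩
    have hφ : φ = f ∘ C.toMCompactification M := funext fun x => (hf x).symm
    subst hφ
    refine ⟨(isCompact_range f.continuous).isBounded.subset (range_comp_subset_range _ _), ?_⟩
    rw [hC.slowlyOscillating_iff]
    intro E hE ε hε
    by_contra hinf
    set I := {x | ∃ y, (x, y) ∈ E ∧ ε ≤ dist ((f ∘ C.toMCompactification M) x)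
      ((f ∘ C.toMCompactification M) y)} with hI
    have hch : ∀ x, ∃ y, x ∈ I → (x, y) ∈ E ∧ ε ≤ dist ((f ∘ C.toMCompactification M) x)
        ((f ∘ C.toMCompactification M) y) := by
      intro x
      by_cases hx : x ∈ I
      · obtain ⟨y, hy⟩ := hx
        exact ⟨y, fun _ => hy⟩
      · exact ⟨x, fun h => (hx h).elim⟩
    choose y hy using hch
    have hne : (Filter.cofinite ⊓ Filter.principal I).NeBot :=
      Filter.cofinite_inf_principal_neBot_iff.2 hinf
    set 𝒰 : Ultrafilter X := Ultrafilter.of (Filter.cofinite ⊓ Filter.principal I) with h𝒰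
    have hle : (𝒰 : Filter X) ≤ Filter.cofinite ⊓ Filter.principal I := Ultrafilter.of_le _
    have h𝒰I : ∀ᶠ x in (𝒰 : Filter X), x ∈ I :=
      (hle.trans inf_le_right) (Filter.mem_principal_self I)
    have h𝒰c : (𝒰 : Filter X) ≤ Filter.cofinite := hle.trans inf_le_left
    obtain ⟨p, hp⟩ : ∃ p, Filter.Tendsto (C.toMCompactification M) 𝒰 (𝓝 p) :=
      ⟨_, (𝒰.map (C.toMCompactification M)).le_nhds_lim⟩
    obtain ⟨q, hq⟩ : ∃ q, Filter.Tendsto (fun x => C.toMCompactification M (y x)) 𝒰 (𝓝 q) :=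
      ⟨_, (𝒰.map fun x => C.toMCompactification M (y x)).le_nhds_lim⟩
    have hpq : p = q := by
      refine Subtype.ext (funext fun s => ?_)
      have hps : Filter.Tendsto (fun x => s.1 x) 𝒰 (𝓝 (p.1 s)) :=
        (((continuous_apply s).comp continuous_subtype_val).tendsto p).comp hp
      have hqs : Filter.Tendsto (fun x => s.1 (y x)) 𝒰 (𝓝 (q.1 s)) :=
        (((continuous_apply s).comp continuous_subtype_val).tendsto q).comp hq
      by_contra hne
      have hd : 0 < dist (p.1 s) (q.1 s) := dist_pos.2 hne
      have hso := hC.slowlyOscillating_iff.1 s.2.2 E hE _ (half_pos hd)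
      have hle : dist (p.1 s) (q.1 s) ≤ dist (p.1 s) (q.1 s) / 2 := by
        refine le_of_tendsto (hps.dist hqs) ?_
        filter_upwards [h𝒰I, h𝒰c hso.compl_mem_cofinite] with x hx hx'
        by_contra hlt
        exact hx' ⟨y x, (hy x hx).1, (not_le.1 hlt).le⟩
      linarith
    have hfd : ε ≤ dist (f p) (f q) := by
      refine ge_of_tendsto (((f.continuous.tendsto p).comp hp).dist
        ((f.continuous.tendsto q).comp hq)) ?_
      filter_upwards [h𝒰I] with x hx using (hy x hx).2
    rw [hpq, dist_self] at hfd
    linarith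
  · intro φ hφ
    exact ⟨⟨fun p => p.1 ⟨φ, hφ⟩, (continuous_apply _).comp continuous_subtype_val⟩,
      fun x => rfl⟩

end CoarseStructure

/-! ### Continuous functions on `K` and cardinal bounds -/

/-- A function on the set of isolated points with zero oscillation at all points extends
continuously to the compactification. -/
theorem mem_uc_of_osc_eq_zero {K : Type u} [TopologicalSpace K] {M : Type v} [MetricSpace M]
    [CompleteSpace M] (hK : Dense (isolatedPoints K)) {φ : isolatedPoints K → M}
    (hφ : ∀ z, osc φ z = 0) : φ ∈ uc (Subtype.val : isolatedPoints K → K) M := by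
  have hlim : ∀ z : K, ∃ c, Filter.Tendsto φ (Filter.comap Subtype.val (𝓝 z)) (𝓝 c) := by
    intro z
    have hne : (Filter.comap (Subtype.val : isolatedPoints K → K) (𝓝 z)).NeBot :=
      hK.isDenseInducing_val.comap_nhds_neBot z
    refine CompleteSpace.complete (EMetric.cauchy_iff.2 ⟨(hne.map φ).ne, fun ε hε => ?_⟩)
    have h0 : osc φ z < ε := by rw [hφ z]; exact hε
    simp only [osc, iInf_lt_iff] at h0
    obtain ⟨O, hO, hz, hd⟩ := h0
    exact ⟨_, Filter.image_mem_map (Filter.preimage_mem_comap (hO.mem_nhds hz)),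
      fun x hx y hy => (Metric.edist_le_ediam_of_mem hx hy).trans_lt hd⟩
  exact ⟨⟨_, hK.continuous_extend hlim⟩, fun x => hK.isDenseInducing_val.extend_eq' hlim x⟩

/-- A homeomorphism fixing the non-isolated points moves the values of a continuous function at
isolated points substantially only finitely often. -/
theorem finite_dist_ge_of_fixes_nonisolated {K : Type u} [TopologicalSpace K] [CompactSpace K]
    {M : Type v} [MetricSpace M] (g : K ≃ₜ K) (hg : ∀ z ∉ isolatedPoints K, g z = z) (f : C(K, M))
    {δ : ℝ} (hδ : 0 < δ) : {x | δ ≤ dist (f (g x)) (f x)}.Finite := by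
  by_contra hinf
  -- An accumulation point is not isolated, so `g` fixes it; but it also lies in the closed set of
  -- points moved by at least `δ`.
  obtain ⟨z, -, hz⟩ := Set.Infinite.exists_accPt_of_subset_isCompact hinf isCompact_univ
    (subset_univ _)
  have hzi : z ∉ isolatedPoints K := by
    intro h
    obtain ⟨y, hy, hne⟩ := accPt_iff_nhds.1 hz {z} (IsOpen.mem_nhds h rfl)
    exact hne hy.1
  have hcl : IsClosed {x | δ ≤ dist (f (g x)) (f x)} :=
    isClosed_le continuous_const ((f.continuous.comp g.continuous).dist f.continuous)
  have hmem : z ∈ {x | δ ≤ dist (f (g x)) (f x)} :=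
    hcl.closure_subset (mem_closure_iff_clusterPt.2 hz.clusterPt)
  simp only [mem_ofPred_eq, hg z hzi, dist_self] at hmem
  linarith

theorem countable_isolatedPoints (K : Type u) [TopologicalSpace K]
    [TopologicalSpace.SeparableSpace K] : (isolatedPoints K).Countable := by
  obtain ⟨s, hs, hd⟩ := TopologicalSpace.exists_countable_dense K
  refine hs.mono fun x hx => ?_
  obtain ⟨_, rfl, h⟩ := hd.inter_open_nonempty _ hx ⟨x, rfl⟩
  exact h

/-- A point is determined by its distances to a dense sequence. -/
theorem mk_le_continuum_of_separable (M : Type v) [MetricSpace M]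
    [TopologicalSpace.SeparableSpace M] : #M ≤ 𝔠 := by
  cases isEmpty_or_nonempty M
  · simp
  have hinj : Function.Injective fun (x : M) (n : ℕ) => dist x (TopologicalSpace.denseSeq M n) := by
    intro x y h
    have hcont : (fun z => dist x z) = fun z => dist y z :=
      (TopologicalSpace.denseRange_denseSeq M).equalizer (by fun_prop) (by fun_prop) h
    have := congrFun hcont y
    simpa using this
  have h : lift.{0} #M ≤ lift.{v} #(ℕ → ℝ) := lift_mk_le'.2 ⟨⟨_, hinj⟩⟩
  simpa [mk_real] using h

/-! ### The coarse structure of a soft compactification -/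

theorem theoremt {M : Type v} [MetricSpace M] [ProperSpace M] [Nontrivial M]
    (has : cardinalAS = 𝔠)
    {K : Type u} [TopologicalSpace K] (hK : IsCompactification K)
    [TopologicalSpace.SeparableSpace K] (hsoft : IsMSoft M K) :
    ∃ C : CoarseStructure (isolatedPoints K), C.IsCellular ∧ C.IsFinitary ∧
      MEquivalent M (Subtype.val : isolatedPoints K → K) (C.toMCompactification M) := by
  classical
  have := hK.compact
  have := hK.t2
  set X := isolatedPoints K with hX
  set U := uc (Subtype.val : X → K) M with hU
  have hXc : Countable X := (countable_isolatedPoints K).to_subtype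
  have hXM : lift.{0} #(X → M) ≤ lift.{max u v} #((ord continuum.{0}).ToType) := by
    rw [mk_ord_toType, lift_continuum, lift_uzero, mk_arrow, ← continuum_power_aleph0]
    have h1 : lift.{u} #M ≤ 𝔠 := by
      rw [lift_le_continuum]; exact mk_le_continuum_of_separable M
    have h2 : lift.{v} #X ≤ ℵ₀ := by rw [lift_le_aleph0]; exact mk_le_aleph0
    exact (power_le_power_right h1).trans (power_le_power_left continuum_ne_zero h2)
  obtain ⟨⟨j, hj⟩⟩ := lift_mk_le'.1 hXM
  obtain ⟨m₀⟩ : Nonempty M := inferInstance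
  have : Nonempty (X → M) := ⟨fun _ => m₀⟩
  -- A left inverse of the injection `j` lists all functions `X → M` along the initial ordinal of
  -- `𝔠`, so fewer than `𝔠` stages precede each one.
  have hsurj : Function.Surjective (Function.invFun j) := Function.invFun_surjective hj
  obtain ⟨S, hS, hSU, hSQ⟩ := exists_superset_of_finite_character (ι := (ord continuum.{0}).ToType)
    (P := Setoid.IsAdmissible U)
    (fun S T h hT => hT.mono h) (fun S h => Setoid.isAdmissible_of_finset h)
    (Setoid.isAdmissible_range_glue U)
    (fun i S => Bornology.IsBounded (range (Function.invFun j i)) → Function.invFun j i ∉ U →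
      ∃ E ∈ finiteJoins S, ¬ E.OscFinite (Function.invFun j i))
    (fun i S T hST h hb hn => by
      obtain ⟨E, hE, h⟩ := h hb hn
      exact ⟨E, finiteJoins_mono hST hE, h⟩)
    (by
      intro i f hf
      set φ : X → M := Function.invFun j i with hφ
      set S := range Setoid.glue ∪ range f with hS
      by_cases hb : Bornology.IsBounded (range φ) ∧ φ ∉ U
      swap
      · refine ⟨Setoid.glue ∅, ?_, fun h1 h2 => (hb ⟨h1, h2⟩).elim⟩
        rwa [insert_eq_of_mem (show Setoid.glue ∅ ∈ S from Or.inl ⟨∅, rfl⟩)]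
      have hosc : ∃ z : K, 0 < osc φ z := by
        by_contra! h
        exact hb.2 (mem_uc_of_osc_eq_zero hK.dense fun z => nonpos_iff_eq_zero.1 (h z))
      obtain ⟨g, hg, ε, hε, hinf⟩ := hsoft φ hb.1 hosc
      have hcard : lift.{0} #(finiteJoins S) < lift.{u} cardinalAS := by
        rw [has, lift_continuum, lift_uzero]
        refine (mk_finiteJoins_le S).trans_lt (max_lt aleph0_lt_continuum ?_)
        refine (mk_union_le _ _).trans_lt (add_lt_of_lt aleph0_le_continuum ?_ ?_)
        · exact (mk_le_aleph0_iff.2 (countable_range _).to_subtype).trans_lt aleph0_lt_continuum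
        · have h1 := mk_range_le_lift (f := f)
          have h2 : lift.{u} #(Iio i) < 𝔠 := by
            rw [lift_lt_continuum]; exact (mk_Iio_lt i (by simp)).trans_eq (by simp)
          exact (by simpa using h1 : #(range f) ≤ lift.{u} #(Iio i)).trans_lt h2
      obtain ⟨F, hF, hFφ⟩ := hf.exists_insert subset_union_left hcard hb.1
        (g := fun x => ⟨g x, g.mem_isolatedPoints x.2⟩)
        (fun x y h => Subtype.ext (g.injective (congrArg Subtype.val h))) hε hinf (by
          rintro ψ ⟨ψ', hψ⟩ δ hδ
          refine ((finite_dist_ge_of_fixes_nonisolated g hg ψ' hδ).preimage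
            Subtype.val_injective.injOn).subset fun x hx => ?_
          have hx' : δ ≤ dist (ψ ⟨g x, g.mem_isolatedPoints x.2⟩) (ψ x) := hx
          rw [← hψ, ← hψ] at hx'
          exact hx')
      exact ⟨F, hF, fun _ _ => hFφ⟩)
  let C : CoarseStructure X := CoarseStructure.ofSetoids (finiteJoins S)
    (fun s hs t ht => ⟨_, sup_mem_finiteJoins hs ht, le_rfl⟩) fun x y =>
      ⟨Setoid.glue {x, y}, mem_finiteJoins (hS ⟨_, rfl⟩), Or.inr (by simp)⟩
  have hCfin : C.IsFinitary := CoarseStructure.isFinitary_ofSetoids fun s hs => (hSU s hs).1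
  refine ⟨C, CoarseStructure.isCellular_ofSetoids, hCfin,
    ⟨hK, Subtype.val_injective, Subtype.range_val⟩, hCfin.isCompactificationOf, ?_⟩
  -- The empty case is separate because finite sets are bounded only when there is a point to centre
  -- a ball at. Here both compactifications are empty by density.
  rcases isEmpty_or_nonempty X with hemp | hne
  · have h1 : IsEmpty K := by
      by_contra h
      rw [not_isEmpty_iff] at h
      obtain ⟨x, hx⟩ := hK.dense.nonempty
      exact hemp.false ⟨x, hx⟩
    have h2 : IsEmpty (C.MCompactification M) := by
      by_contra h
      rw [not_isEmpty_iff] at h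
      exact hemp.false
        (CoarseStructure.denseRange_toMCompactification (C := C) (M := M)).nonempty.some
    refine Subset.antisymm ?_ ?_
    · exact fun φ _ => ⟨⟨fun p => h2.elim p, by fun_prop⟩, fun x => hemp.elim x⟩
    · exact fun φ _ => ⟨⟨fun p => h1.elim p, by fun_prop⟩, fun x => hemp.elim x⟩
  rw [hCfin.uc_toMCompactification]
  refine Subset.antisymm ?_ ?_
  · intro φ hφ
    obtain ⟨f, hf⟩ := id hφ
    refine ⟨(isCompact_range f.continuous).isBounded.subset ?_, ?_⟩
    · rintro _ ⟨x, rfl⟩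
      exact ⟨x, hf x⟩
    · rw [hCfin.slowlyOscillating_iff]
      rintro E ⟨-, s, hs, hEs⟩ ε hε
      exact ((hSU s hs).2 φ hφ ε hε).subset fun x ⟨y, hxy, hd⟩ => ⟨y, hEs x y hxy, hd⟩
  -- A bounded function outside `U` was spoiled at its own stage by a join that is now an entourage.
  · rintro φ ⟨hb, hso⟩
    by_contra hn
    obtain ⟨i, rfl⟩ := hsurj φ
    obtain ⟨E, hE, hosc⟩ := hSQ i hb hn
    exact hosc fun ε hε => hCfin.slowlyOscillating_iff.1 hso _
      (CoarseStructure.setoid_mem_ofSetoids hE) ε hε
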